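/- For a finite simple graph $G$ let $$AZI(G)=\sum_{uv\in E(G)}\left(\frac{d_ud_v}{d_u+d_v-2}\right)^{3},$$ where $d_u$ denotes the degree of the vertex $u$. A path $v_1v_2\cdots v_{l+1}$ of length $l$ in $G$ is called internal if $d_{v_1}>2$, $d_{v_{l+1}}>2$, and $d_{v_i}=2$ for all $2\le i\le l$; it is called pendent if one of $d_{v_1},d_{v_{l+1}}$ equals $1$, the other is greater than $2$, and $d_{v_i}=2$ for all $2\le i\le l$. Theorem 2. Let $n\ge 10$, and let $T^*$ be a tree on $n$ vertices whose $AZI$ is maximum among all trees on $n$ vertices. Then: (1) $T^*$ contains no internal path of length $l\ge 2$; (2) $T^*$ contains no pendent path of length $l\ge 4$; (3) $T^*$ contains at most one pendent path of length $3$ (a path and its reversal being the same path). -/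

import Mathlib

/-- The contribution `(x y / (x + y - 2))³` of an edge whose ends have degrees `x` and `y`. -/
noncomputable def aziWeight (x y : ℝ) : ℝ := (x * y / (x + y - 2)) ^ 3

theorem aziWeight_comm (x y : ℝ) : aziWeight x y = aziWeight y x := by
  simp only [aziWeight, mul_comm x y, add_comm x y]

namespace SimpleGraph

variable {V : Type*} [Fintype V]

open Classical in
/-- The augmented Zagreb index
`AZI(G) = ∑_{uv ∈ E(G)} (d_u d_v / (d_u + d_v - 2))³` of a finite simple graph. -/
noncomputable def azi (G : SimpleGraph V) : ℝ :=
  ∑ e ∈ G.edgeFinset,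
    Sym2.lift ⟨fun u v => aziWeight (G.degree u) (G.degree v),
      fun _ _ => aziWeight_comm _ _⟩ e

/-- `T` is a tree, and its `AZI` is maximum among all trees with the same number of vertices
(up to isomorphism these are the trees on the vertex type of `T`). -/
def IsMaxAziTree (T : SimpleGraph V) : Prop :=
  T.IsTree ∧ ∀ T' : SimpleGraph V, T'.IsTree → azi T' ≤ azi T

open Classical in
/-- A path is internal if both of its ends have degree greater than 2 and all of its inner
vertices have degree 2. -/
def IsInternalPath {G : SimpleGraph V} {u v : V} (p : G.Walk u v) : Prop :=
  p.IsPath ∧ 2 < G.degree u ∧ 2 < G.degree v ∧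
    ∀ i, 0 < i → i < p.length → G.degree (p.getVert i) = 2

open Classical in
/-- A path is pendent if one of its ends has degree 1, the other has degree greater than 2,
and all of its inner vertices have degree 2. -/
def IsPendentPath {G : SimpleGraph V} {u v : V} (p : G.Walk u v) : Prop :=
  p.IsPath ∧
    (G.degree u = 1 ∧ 2 < G.degree v ∨ 2 < G.degree u ∧ G.degree v = 1) ∧
    ∀ i, 0 < i → i < p.length → G.degree (p.getVert i) = 2

end SimpleGraph

/-! Every argument compares edge weights with 8. An edge with an end of degree 2 weighs exactly 8.
An edge from a leaf weighs at most 8, strictly less if its other end branches (degree at least 3).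
An edge between two branching vertices weighs more than 8, and more still when one of these degrees
grows.

For (1), suppressing a degree-2 vertex of an internal path and hanging it at a leaf never lowers AZI
(`IsTree.exists_suppress`). At length 2 this creates an edge between branching vertices, a strict
gain. At greater length AZI does not drop, so the new tree is again maximum and has a shorter
internal path; induct.

For (2), a maximum tree on at least 10 vertices has two adjacent branching vertices: without them
AZI is at most 8(n-1), and an explicit double spider exceeds that (`exists_isTree_lt_azi`). Given a
pendent path of length at least 4, cut off its last two vertices and hang them at one of these
branching vertices. The edge joining the two gets heavier. An edge to a leaf could get lighter
there, but no leaf hangs at a branching vertex: moving the end of the pendent path onto that leaf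
would already raise AZI.

For (3), given two pendent paths of length 3, moving the leaf of one to the end of the other does
not lower AZI, so the tree stays maximum. It then has a pendent chain of length 4, excluded as in
(2). -/

/-! ### Edge weights compared with 8 -/

theorem aziWeight_two_left {d : ℕ} (hd : 1 ≤ d) : aziWeight ((2 : ℕ) : ℝ) d = 8 := by
  have : (d : ℝ) ≠ 0 := by positivity
  have h : ((2 : ℕ) : ℝ) * d / ((2 : ℕ) + d - 2) = 2 := by
    push_cast
    rw [add_sub_cancel_left, mul_div_assoc, div_self this, mul_one]
  rw [aziWeight, h]
  norm_num

theorem aziWeight_two_right {d : ℕ} (hd : 1 ≤ d) : aziWeight d ((2 : ℕ) : ℝ) = 8 := by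
  rw [aziWeight_comm, aziWeight_two_left hd]

theorem aziWeight_one_left_lt {d : ℕ} (hd : 3 ≤ d) : aziWeight ((1 : ℕ) : ℝ) d < 8 := by
  have h3 : (3 : ℝ) ≤ d := by exact_mod_cast hd
  have h : ((1 : ℕ) : ℝ) * d / ((1 : ℕ) + d - 2) < 2 := by
    push_cast
    rw [div_lt_iff₀] <;> linarith
  have h0 : 0 ≤ ((1 : ℕ) : ℝ) * d / ((1 : ℕ) + d - 2) := by
    push_cast
    exact div_nonneg (by linarith) (by linarith)
  calc aziWeight ((1 : ℕ) : ℝ) d < 2 ^ 3 := pow_lt_pow_left₀ h h0 (by norm_num)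
    _ = 8 := by norm_num

theorem aziWeight_one_left_le (d : ℕ) : aziWeight ((1 : ℕ) : ℝ) d ≤ 8 := by
  rcases lt_or_ge d 3 with h | h
  -- For d = 1 the denominator vanishes, and division by zero gives weight 0.
  · interval_cases d <;> norm_num [aziWeight]
  · exact (aziWeight_one_left_lt h).le

/-- The base of the cube exceeds 2 exactly because (a - 2)(b - 2) > 0. -/
theorem eight_lt_aziWeight {a b : ℕ} (ha : 3 ≤ a) (hb : 3 ≤ b) : 8 < aziWeight a b := by
  have h3 : (3 : ℝ) ≤ a := by exact_mod_cast ha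
  have h4 : (3 : ℝ) ≤ b := by exact_mod_cast hb
  have h : 2 < (a : ℝ) * b / (a + b - 2) := by
    rw [lt_div_iff₀ (by linarith)]
    nlinarith
  calc (8 : ℝ) = 2 ^ 3 := by norm_num
    _ < _ := pow_lt_pow_left₀ h (by norm_num) (by norm_num)

/-- After clearing denominators the difference is y(y - 2), positive for y > 2. -/
theorem aziWeight_lt_succ_left {x y : ℕ} (hx : 3 ≤ x) (hy : 3 ≤ y) :
    aziWeight x y < aziWeight (x + 1 : ℕ) y := by
  have h3 : (3 : ℝ) ≤ x := by exact_mod_cast hx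
  have h4 : (3 : ℝ) ≤ y := by exact_mod_cast hy
  refine pow_lt_pow_left₀ ?_ (div_nonneg (by positivity) (by linarith)) (by norm_num)
  push_cast
  rw [div_lt_div_iff₀ (by linarith) (by linarith)]
  nlinarith

theorem aziWeight_le_succ_left {x y : ℕ} (hx : 3 ≤ x) (hy : 2 ≤ y) :
    aziWeight x y ≤ aziWeight (x + 1 : ℕ) y := by
  rcases hy.eq_or_lt with rfl | h
  · rw [aziWeight_two_right (by omega), aziWeight_two_right (by omega)]
  · exact (aziWeight_lt_succ_left hx h).le

/-! ### Moving one end of a tree edge -/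

namespace SimpleGraph

variable {V : Type*}

/-- The contribution of an edge under a prescribed degree function. -/
noncomputable def edgeWeight (d : V → ℕ) (e : Sym2 V) : ℝ :=
  Sym2.lift ⟨fun u v => aziWeight (d u) (d v), fun _ _ => aziWeight_comm _ _⟩ e

@[simp] theorem edgeWeight_mk (d : V → ℕ) (u v : V) :
    edgeWeight d s(u, v) = aziWeight (d u) (d v) := rfl

/-- Replace the edge `bc` by the edge `bx`. -/
def slide (G : SimpleGraph V) (b c x : V) : SimpleGraph V := G.deleteEdges {s(b, c)} ⊔ edge b x

theorem slide_adj {G : SimpleGraph V} {b c x p q : V} : (G.slide b c x).Adj p q ↔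
    G.Adj p q ∧ ¬ (p = b ∧ q = c ∨ p = c ∧ q = b) ∨
      (p = b ∧ q = x ∨ p = x ∧ q = b) ∧ p ≠ q := by
  simp [slide, edge_adj]

theorem reachable_of_forall_adj {G G' : SimpleGraph V} (h : ∀ p q, G.Adj p q → G'.Reachable p q)
    {a b : V} (hab : G.Reachable a b) : G'.Reachable a b := by
  obtain ⟨p⟩ := hab
  induction p with
  | nil => rfl
  | cons h' _ ih => exact (h _ _ h').trans ih

theorem Connected.reachable_deleteEdges_or {G : SimpleGraph V} (hG : G.Connected) (b c x : V) :
    (G.deleteEdges {s(b, c)}).Reachable b x ∨ (G.deleteEdges {s(b, c)}).Reachable c x := by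
  obtain ⟨p⟩ := hG.preconnected x b
  induction p with
  | nil => left; rfl
  | @cons u v w h p ih =>
    by_cases he : s(u, v) = s(w, c)
    · rcases Sym2.eq_iff.1 he with ⟨rfl, rfl⟩ | ⟨rfl, rfl⟩
      · left; rfl
      · right; rfl
    · have : (G.deleteEdges {s(w, c)}).Adj v u := by
        rw [deleteEdges_adj]
        exact ⟨h.symm, fun h' => he (Sym2.eq_swap.trans h')⟩
      exact ih.imp (fun h => h.trans this.reachable) (fun h => h.trans this.reachable)

/-- If bc is the only edge leaving S, a walk from b avoiding bc is trapped in S, so vertices outside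
S lie on the side of c. -/
theorem Connected.reachable_deleteEdges_of_notMem {G : SimpleGraph V} (hG : G.Connected)
    {b c x : V} (S : Set V) (hb : b ∈ S)
    (hS : ∀ p ∈ S, ∀ q, G.Adj p q → q ∉ S → p = b ∧ q = c) (hx : x ∉ S) :
    (G.deleteEdges {s(b, c)}).Reachable c x := by
  refine (hG.reachable_deleteEdges_or b c x).resolve_left fun ⟨p⟩ => hx ?_
  clear hx
  have key : ∀ {u w : V}, (G.deleteEdges {s(b, c)}).Walk u w → u ∈ S → w ∈ S := by
    intro u w p
    induction p with
    | nil => exact id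
    | @cons u v w h p ih =>
      intro hu
      refine ih (by_contra fun hv => ?_)
      rw [deleteEdges_adj] at h
      obtain ⟨rfl, rfl⟩ := hS _ hu _ h.1 hv
      exact h.2 rfl
  exact key p hb

theorem IsTree.not_adj_of_reachable_deleteEdges {G : SimpleGraph V} (hG : G.IsTree) {b c x : V}
    (hbc : G.Adj b c) (hx : (G.deleteEdges {s(b, c)}).Reachable c x) :
    ¬ (G.deleteEdges {s(b, c)}).Reachable b x := fun h =>
  isAcyclic_iff_forall_adj_isBridge.1 hG.isAcyclic hbc (h.trans hx.symm)

/-- Deleting bc leaves two components; x lies in that of c, so bx reconnects them without closing a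
cycle. -/
theorem IsTree.slide {G : SimpleGraph V} (hG : G.IsTree) {b c x : V}
    (hbc : G.Adj b c) (hx : (G.deleteEdges {s(b, c)}).Reachable c x) :
    (G.slide b c x).IsTree := by
  have hnr := hG.not_adj_of_reachable_deleteEdges hbc hx
  have hbx : b ≠ x := by rintro rfl; exact hnr .rfl
  refine ⟨?_, (hG.isAcyclic.anti (deleteEdges_le _)).sup_edge_of_not_reachable hnr⟩
  have := hG.connected.nonempty
  refine ⟨fun u v => reachable_of_forall_adj (fun p q h => ?_) (hG.connected.preconnected u v)⟩
  have key : (G.slide b c x).Reachable b c :=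
    (Adj.reachable (slide_adj.2 (Or.inr ⟨Or.inl ⟨rfl, rfl⟩, hbx⟩))).trans
      (hx.mono le_sup_left).symm
  by_cases h1 : p = b ∧ q = c
  · rw [h1.1, h1.2]; exact key
  by_cases h2 : p = c ∧ q = b
  · rw [h2.1, h2.2]; exact key.symm
  · exact Adj.reachable (slide_adj.2 (Or.inl ⟨h, by tauto⟩))

/-! ### Degrees and AZI under an exchange of edges -/

section Degree

variable [Fintype V] {G : SimpleGraph V}

open Classical in
theorem degree_slide {b c x : V} (hbc : G.Adj b c) (hbx : ¬ G.Adj b x) (hne : b ≠ x) (v : V) :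
    (G.slide b c x).degree v =
      if v = c then G.degree v - 1 else if v = x then G.degree v + 1 else G.degree v := by
  have hcx : c ≠ x := by rintro rfl; exact hbx hbc
  have hbc' := hbc.ne
  split_ifs with h1 h2
  · subst h1
    have : (G.slide b v x).neighborFinset v = (G.neighborFinset v).erase b := by
      ext q
      simp only [mem_neighborFinset, slide_adj, Finset.mem_erase]
      grind
    rw [← card_neighborFinset_eq_degree, this, Finset.card_erase_of_mem (by simpa using hbc.symm),
      card_neighborFinset_eq_degree]
  · subst h2
    have : (G.slide b c v).neighborFinset v = insert b (G.neighborFinset v) := by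
      ext q
      simp only [mem_neighborFinset, slide_adj, Finset.mem_insert]
      grind
    rw [← card_neighborFinset_eq_degree, this, Finset.card_insert_of_notMem
      (by simpa [adj_comm] using hbx), card_neighborFinset_eq_degree]
  · by_cases hvb : v = b
    · subst hvb
      have : (G.slide v c x).neighborFinset v = insert x ((G.neighborFinset v).erase c) := by
        ext q
        simp only [mem_neighborFinset, slide_adj, Finset.mem_insert, Finset.mem_erase]
        grind
      rw [← card_neighborFinset_eq_degree, this, Finset.card_insert_of_notMem (by simp [hbx]),
        Finset.card_erase_of_mem (by simpa using hbc), card_neighborFinset_eq_degree]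
      -- Positivity makes the truncated `degree - 1 + 1` equal to the degree.
      have := (G.degree_pos_iff_exists_adj v).2 ⟨c, hbc⟩
      omega
    · have : (G.slide b c x).neighborFinset v = G.neighborFinset v := by
        ext q
        simp only [mem_neighborFinset, slide_adj]
        grind
      rw [← card_neighborFinset_eq_degree, this, card_neighborFinset_eq_degree]

open Classical in
theorem eq_of_degree_eq_one {a b q : V} (ha : G.degree a = 1) (hb : G.Adj a b) (hq : G.Adj a q) :
    q = b :=
  (degree_eq_one_iff_existsUnique_adj.1 ha).unique hq hb

open Classical in
theorem eq_or_eq_of_degree_eq_two {a b c q : V} (ha : G.degree a = 2) (hb : G.Adj a b)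
    (hc : G.Adj a c) (hbc : b ≠ c) (hq : G.Adj a q) : q = b ∨ q = c := by
  by_contra! h
  have : ({q, b, c} : Finset V) ⊆ G.neighborFinset a := by
    intro v
    simp only [Finset.mem_insert, Finset.mem_singleton, mem_neighborFinset]
    rintro (rfl | rfl | rfl) <;> assumption
  have := Finset.card_le_card this
  rw [card_neighborFinset_eq_degree, ha, Finset.card_eq_three.2 ⟨q, b, c, h.1, h.2, hbc, rfl⟩] at this
  omega

open Classical in
theorem azi_eq_sum_edgeWeight (G : SimpleGraph V) :
    azi G = ∑ e ∈ G.edgeFinset, edgeWeight (fun v => G.degree v) e := rfl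

open Classical in
theorem azi_add_sum_le {G' : SimpleGraph V} {A B : Finset (Sym2 V)} (hA : A ⊆ G.edgeFinset)
    (hB : Disjoint (G.edgeFinset \ A) B) (hE : G'.edgeFinset = (G.edgeFinset \ A) ∪ B)
    (hle : ∀ p q, G.Adj p q → s(p, q) ∉ A →
      aziWeight (G.degree p) (G.degree q) ≤ aziWeight (G'.degree p) (G'.degree q)) :
    azi G + ∑ e ∈ B, edgeWeight (fun v => G'.degree v) e ≤
      azi G' + ∑ e ∈ A, edgeWeight (fun v => G.degree v) e := by
  rw [azi_eq_sum_edgeWeight G, azi_eq_sum_edgeWeight G', hE, Finset.sum_union hB,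
    ← Finset.sum_sdiff hA]
  have : ∑ e ∈ G.edgeFinset \ A, edgeWeight (fun v => G.degree v) e ≤
      ∑ e ∈ G.edgeFinset \ A, edgeWeight (fun v => G'.degree v) e := by
    refine Finset.sum_le_sum fun e he => ?_
    induction e with
    | h p q =>
      rw [Finset.mem_sdiff, mem_edgeFinset] at he
      exact hle p q he.1 he.2
  linarith

open Classical in
theorem azi_add_sum_lt {G' : SimpleGraph V} {A B : Finset (Sym2 V)} (hA : A ⊆ G.edgeFinset)
    (hB : Disjoint (G.edgeFinset \ A) B) (hE : G'.edgeFinset = (G.edgeFinset \ A) ∪ B)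
    (hle : ∀ p q, G.Adj p q → s(p, q) ∉ A →
      aziWeight (G.degree p) (G.degree q) ≤ aziWeight (G'.degree p) (G'.degree q))
    (hlt : ∃ p q, G.Adj p q ∧ s(p, q) ∉ A ∧
      aziWeight (G.degree p) (G.degree q) < aziWeight (G'.degree p) (G'.degree q)) :
    azi G + ∑ e ∈ B, edgeWeight (fun v => G'.degree v) e <
      azi G' + ∑ e ∈ A, edgeWeight (fun v => G.degree v) e := by
  rw [azi_eq_sum_edgeWeight G, azi_eq_sum_edgeWeight G', hE, Finset.sum_union hB,
    ← Finset.sum_sdiff hA]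
  have : ∑ e ∈ G.edgeFinset \ A, edgeWeight (fun v => G.degree v) e <
      ∑ e ∈ G.edgeFinset \ A, edgeWeight (fun v => G'.degree v) e := by
    refine Finset.sum_lt_sum (fun e he => ?_) ?_
    · induction e with
      | h p q =>
        rw [Finset.mem_sdiff, mem_edgeFinset] at he
        exact hle p q he.1 he.2
    · obtain ⟨p, q, h1, h2, h3⟩ := hlt
      exact ⟨s(p, q), by rw [Finset.mem_sdiff, mem_edgeFinset]; exact ⟨h1, h2⟩, h3⟩
  linarith

end Degree

end SimpleGraph

/-! ### Slides along chains of degree-2 vertices -/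

namespace SimpleGraph

variable {V : Type*} [Fintype V] {G T : SimpleGraph V}

open Classical in
theorem edgeFinset_slide {b c x : V} (hne : b ≠ x) :
    (G.slide b c x).edgeFinset = (G.edgeFinset \ {s(b, c)}) ∪ {s(b, x)} := by
  ext e
  induction e with
  | h p q =>
    simp only [mem_edgeFinset, mem_edgeSet, slide_adj, Finset.mem_union, Finset.mem_sdiff,
      Finset.mem_singleton, Sym2.eq_iff]
    grind

-- Only edges at c or x can change weight. Apart from bc, the one edge at c is cd, which weighs 8
-- before and after because d has degree 2; the edges at x are covered by `hx`.
open Classical in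
theorem aziWeight_degree_le_slide {b c d x : V} (hbc : G.Adj b c) (hbx : ¬ G.Adj b x)
    (hne : b ≠ x) (hcx : ¬ G.Adj c x) (hc : G.degree c = 2) (hcd : G.Adj c d) (hbd : b ≠ d)
    (hd : G.degree d = 2)
    (hx : ∀ q, G.Adj x q →
      aziWeight (G.degree x) (G.degree q) ≤ aziWeight (G.degree x + 1 : ℕ) (G.degree q))
    (p q : V) (hpq : G.Adj p q) (hpq' : s(p, q) ∉ ({s(b, c)} : Finset (Sym2 V))) :
    aziWeight (G.degree p) (G.degree q) ≤
      aziWeight ((G.slide b c x).degree p) ((G.slide b c x).degree q) := by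
  have key : ∀ p q : V, G.Adj p q → s(p, q) ∉ ({s(b, c)} : Finset (Sym2 V)) → (p = c ∨ p = x) →
      aziWeight (G.degree p) (G.degree q) ≤
        aziWeight ((G.slide b c x).degree p) ((G.slide b c x).degree q) := by
    intro p q hpq hpq' hp
    have hdx : d ≠ x := by rintro rfl; exact hcx hcd
    have hcx' : c ≠ x := by rintro rfl; exact hbx hbc
    rw [degree_slide hbc hbx hne, degree_slide hbc hbx hne]
    rcases hp with rfl | rfl
    · have hq : q = d := by
        rcases eq_or_eq_of_degree_eq_two hc hbc.symm hcd hbd hpq with rfl | h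
        · exact absurd (by simp) hpq'
        · exact h
      subst hq
      rw [if_pos rfl, if_neg hcd.ne', if_neg hdx, hc, hd, aziWeight_two_right (by omega),
        aziWeight_two_right (by omega)]
    · have h1 : q ≠ c := by rintro rfl; exact hcx hpq.symm
      rw [if_neg hcx'.symm, if_pos rfl, if_neg h1, if_neg hpq.ne']
      exact hx q hpq
  by_cases hp : p = c ∨ p = x
  · exact key p q hpq hpq' hp
  by_cases hq : q = c ∨ q = x
  · rw [aziWeight_comm, aziWeight_comm ((G.slide b c x).degree p : ℝ)]
    exact key q p hpq.symm (by rwa [Sym2.eq_swap (a := q) (b := p)]) hq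
  push Not at hp hq
  rw [degree_slide hbc hbx hne, degree_slide hbc hbx hne, if_neg hp.1, if_neg hp.2, if_neg hq.1,
    if_neg hq.2]

-- The new edge has an end of degree 2: either b had degree 2 and keeps it, or the leaf x reaches
-- degree 2. So trading bc for bx is neutral.
open Classical in
theorem aziWeight_slide_edges {b c x : V} (hbc : G.Adj b c) (hbx : ¬ G.Adj b x)
    (hne : b ≠ x) (hc : G.degree c = 2) (h : G.degree b = 2 ∨ G.degree x = 1) :
    aziWeight (G.degree b) (G.degree c) = 8 ∧
      aziWeight ((G.slide b c x).degree b) ((G.slide b c x).degree x) = 8 := by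
  have hb := (G.degree_pos_iff_exists_adj b).2 ⟨c, hbc⟩
  have hcx' : c ≠ x := by rintro rfl; exact hbx hbc
  rw [degree_slide hbc hbx hne, degree_slide hbc hbx hne, if_neg hbc.ne, if_neg hne,
    if_neg hcx'.symm, if_pos rfl, hc]
  refine ⟨aziWeight_two_right hb, ?_⟩
  rcases h with h | h <;> rw [h]
  · exact aziWeight_two_left (by omega)
  · exact aziWeight_two_right hb

open Classical in
theorem azi_le_slide {b c d x : V} (hbc : G.Adj b c) (hbx : ¬ G.Adj b x)
    (hne : b ≠ x) (hcx : ¬ G.Adj c x) (hc : G.degree c = 2) (hcd : G.Adj c d) (hbd : b ≠ d)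
    (hd : G.degree d = 2) (h : G.degree b = 2 ∨ G.degree x = 1)
    (hx : ∀ q, G.Adj x q →
      aziWeight (G.degree x) (G.degree q) ≤ aziWeight (G.degree x + 1 : ℕ) (G.degree q)) :
    azi G ≤ azi (G.slide b c x) := by
  have := azi_add_sum_le (G := G) (by simpa using hbc)
    (Finset.disjoint_singleton_right.2 (by simp [hbx]))
    (edgeFinset_slide (c := c) hne)
    (aziWeight_degree_le_slide hbc hbx hne hcx hc hcd hbd hd hx)
  simp only [Finset.sum_singleton, edgeWeight_mk] at this
  rw [(aziWeight_slide_edges hbc hbx hne hc h).1, (aziWeight_slide_edges hbc hbx hne hc h).2] at this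
  linarith

open Classical in
theorem azi_lt_slide {b c d x y : V} (hbc : G.Adj b c) (hbx : ¬ G.Adj b x)
    (hne : b ≠ x) (hcx : ¬ G.Adj c x) (hc : G.degree c = 2) (hcd : G.Adj c d) (hbd : b ≠ d)
    (hd : G.degree d = 2) (h : G.degree b = 2 ∨ G.degree x = 1)
    (hx : ∀ q, G.Adj x q →
      aziWeight (G.degree x) (G.degree q) ≤ aziWeight (G.degree x + 1 : ℕ) (G.degree q))
    (hxy : G.Adj x y)
    (hlt : aziWeight (G.degree x) (G.degree y) < aziWeight (G.degree x + 1 : ℕ) (G.degree y)) :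
    azi G < azi (G.slide b c x) := by
  have hcx' : c ≠ x := by rintro rfl; exact hbx hbc
  have := azi_add_sum_lt (G := G) (by simpa using hbc)
    (Finset.disjoint_singleton_right.2 (by simp [hbx]))
    (edgeFinset_slide (c := c) hne)
    (aziWeight_degree_le_slide hbc hbx hne hcx hc hcd hbd hd hx) ⟨x, y, hxy, ?_, ?_⟩
  · simp only [Finset.sum_singleton, edgeWeight_mk] at this
    rw [(aziWeight_slide_edges hbc hbx hne hc h).1,
      (aziWeight_slide_edges hbc hbx hne hc h).2] at this
    linarith
  · simp only [Finset.mem_singleton, Sym2.eq_iff]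
    rintro (h | h)
    · exact hne h.1.symm
    · exact hcx' h.1.symm
  · have h1 : y ≠ c := by rintro rfl; exact hcx hxy.symm
    rw [degree_slide hbc hbx hne, degree_slide hbc hbx hne, if_neg hcx'.symm, if_pos rfl, if_neg h1,
      if_neg hxy.ne']
    exact hlt

/-! ### Pendent chains in a maximum tree -/

open Classical in
theorem IsTree.reachable_of_leaf (hT : T.IsTree) {a b y : V} (ha : T.degree a = 1)
    (hab : T.Adj a b) (hy : y ≠ a) : (T.deleteEdges {s(a, b)}).Reachable b y := by
  refine hT.connected.reachable_deleteEdges_of_notMem {a} rfl ?_ (by simpa using hy)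
  rintro p rfl q hq -
  exact ⟨rfl, eq_of_degree_eq_one ha hab hq⟩

open Classical in
/-- If a maximal tree has a pendent chain of length three, no leaf hangs at a branching vertex. -/
theorem IsMaxAziTree.degree_le_two_of_chain (hT : T.IsMaxAziTree) {a b c y z : V}
    (hab : T.Adj a b) (hbc : T.Adj b c) (ha : T.degree a = 1) (hb : T.degree b = 2)
    (hc : T.degree c = 2) (hyz : T.Adj y z) (hy : T.degree y = 1) : T.degree z ≤ 2 := by
  by_contra! hz
  have hac : a ≠ c := by rintro rfl; omega
  have hay : a ≠ y := by
    rintro rfl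
    obtain rfl := eq_of_degree_eq_one ha hab hyz
    omega
  have hnay : ¬ T.Adj a y := fun h => by
    obtain rfl := eq_of_degree_eq_one ha hab h
    omega
  have hnby : ¬ T.Adj b y := fun h => by
    obtain rfl := eq_of_degree_eq_one hy hyz h.symm
    omega
  -- Moving a from b to y lifts the weight of yz from below 8 to exactly 8.
  refine (hT.2 _ (hT.1.slide hab (hT.1.reachable_of_leaf ha hab hay.symm))).not_gt
    (azi_lt_slide hab hnay hay hnby hb hbc hac hc (Or.inr hy) ?_ hyz ?_)
  · intro q hq
    obtain rfl := eq_of_degree_eq_one hy hyz hq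
    rw [hy, aziWeight_two_left (by omega)]
    exact aziWeight_one_left_le _
  · rw [hy, aziWeight_two_left (by omega)]
    exact aziWeight_one_left_lt hz

open Classical in
/-- A maximal tree containing two adjacent branching vertices has no pendent chain of length
four. -/
theorem IsMaxAziTree.not_chain_of_adj (hT : T.IsMaxAziTree) {x y : V} (hxy : T.Adj x y)
    (hx : 3 ≤ T.degree x) (hy : 3 ≤ T.degree y) {a b c d : V}
    (hab : T.Adj a b) (hbc : T.Adj b c) (hcd : T.Adj c d) (hbd : b ≠ d)
    (ha : T.degree a = 1) (hb : T.degree b = 2) (hc : T.degree c = 2) (hd : T.degree d = 2) :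
    False := by
  have hac : a ≠ c := by rintro rfl; omega
  have hbx : b ≠ x := by rintro rfl; omega
  have hnbx : ¬ T.Adj b x := fun h => by
    rcases eq_or_eq_of_degree_eq_two hb hab.symm hbc hac h with rfl | rfl <;> omega
  have hncx : ¬ T.Adj c x := fun h => by
    rcases eq_or_eq_of_degree_eq_two hc hbc.symm hcd hbd h with rfl | rfl <;> omega
  have hr : (T.deleteEdges {s(b, c)}).Reachable c x := by
    refine hT.1.connected.reachable_deleteEdges_of_notMem {a, b} (by simp) ?_ ?_
    · rintro p (rfl | rfl) q hq hq'
      · exact absurd (eq_of_degree_eq_one ha hab hq) fun h => hq' (by simp [h])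
      · refine ⟨rfl, (eq_or_eq_of_degree_eq_two hb hab.symm hbc hac hq).resolve_left ?_⟩
        exact fun h => hq' (by simp [h])
    · rintro (rfl | rfl) <;> omega
  -- The piece ab is cut from c and hung at x, which makes xy heavier.
  refine (hT.2 _ (hT.1.slide hbc hr)).not_gt
    (azi_lt_slide hbc hnbx hbx hncx hc hcd hbd hd (Or.inl hb) ?_ hxy ?_)
  · intro q hq
    refine aziWeight_le_succ_left hx ?_
    by_contra! hq2
    have h1 := (T.degree_pos_iff_exists_adj q).2 ⟨x, hq.symm⟩
    -- A leaf at x is the only neighbour whose edge could lose weight.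
    have := hT.degree_le_two_of_chain hab hbc ha hb hc hq.symm (by omega)
    omega
  · exact aziWeight_lt_succ_left hx hy

open Classical in
/-- Sliding the end of one pendent chain of length three to the end of another one keeps the tree
maximal. -/
theorem IsMaxAziTree.slide_leaf (hT : T.IsMaxAziTree) {a b c y z : V}
    (hab : T.Adj a b) (hbc : T.Adj b c) (ha : T.degree a = 1) (hb : T.degree b = 2)
    (hc : T.degree c = 2) (hyz : T.Adj y z) (hy : T.degree y = 1) (hay : a ≠ y) (hzb : z ≠ b) :
    (T.slide a b y).IsMaxAziTree := by
  have hac : a ≠ c := by rintro rfl; omega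
  have hnay : ¬ T.Adj a y := fun h => by
    obtain rfl := eq_of_degree_eq_one ha hab h
    omega
  have hnby : ¬ T.Adj b y := fun h => hzb (eq_of_degree_eq_one hy hyz h.symm).symm
  refine ⟨hT.1.slide hab (hT.1.reachable_of_leaf ha hab hay.symm), fun T' hT' =>
    (hT.2 T' hT').trans (azi_le_slide hab hnay hay hnby hb hbc hac hc (Or.inr hy) ?_)⟩
  intro q hq
  have := (T.degree_pos_iff_exists_adj q).2 ⟨y, hq.symm⟩
  rw [hy, aziWeight_two_left (by omega)]
  exact aziWeight_one_left_le _

end SimpleGraph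

/-! ### A tree with AZI above 8(n - 1) -/

namespace SimpleGraph

section Parent

variable {V : Type*}

/-- The graph in which every vertex except the root is joined to its parent. -/
def parentGraph (f : V → V) (root : V) : SimpleGraph V :=
  fromRel fun u v => u ≠ root ∧ f u = v

variable {f : V → V} {root : V} {r : V → ℕ}

theorem parentGraph_adj (h : ∀ v, v ≠ root → r (f v) < r v) {u v : V} :
    (parentGraph f root).Adj u v ↔ u ≠ root ∧ f u = v ∨ v ≠ root ∧ f v = u := by
  rw [parentGraph, fromRel_adj, and_iff_right_iff_imp]
  rintro h' rfl
  rcases h' with ⟨h1, h2⟩ | ⟨h1, h2⟩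
  all_goals
    have := h u h1
    rw [h2] at this
    exact this.false

theorem parentGraph_injOn (h : ∀ v, v ≠ root → r (f v) < r v) :
    Set.InjOn (fun v => s(v, f v)) {v | v ≠ root} := by
  intro u hu v hv huv
  rcases Sym2.eq_iff.1 huv with h' | ⟨h1, h2⟩
  · exact h'.1
  · have hu := h u hu
    have hv := h v hv
    rw [h2] at hu
    rw [← h1] at hv
    exact absurd hu hv.not_gt

open Classical in
theorem edgeFinset_parentGraph [Fintype V] (h : ∀ v, v ≠ root → r (f v) < r v) :
    (parentGraph f root).edgeFinset = (Finset.univ.erase root).image fun v => s(v, f v) := by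
  ext e
  induction e with
  | h p q =>
    simp only [mem_edgeFinset, mem_edgeSet, parentGraph_adj h, Finset.mem_image, Finset.mem_erase,
      Finset.mem_univ, and_true, Sym2.eq_iff]
    grind

/-- The rank `r` falls along parents, so every vertex reaches the root, and the n - 1 parent edges
are distinct. -/
theorem isTree_parentGraph [Fintype V] (h : ∀ v, v ≠ root → r (f v) < r v) :
    (parentGraph f root).IsTree := by
  classical
  have hr : ∀ n v, r v = n → (parentGraph f root).Reachable v root := by
    intro n
    induction n using Nat.strong_induction_on with
    | _ n ih =>
      rintro v rfl
      by_cases hv : v = root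
      · rw [hv]
      · exact (Adj.reachable ((parentGraph_adj h).2 (Or.inl ⟨hv, rfl⟩))).trans
          (ih _ (h v hv) _ rfl)
  have : Nonempty V := ⟨root⟩
  refine isTree_iff_connected_and_card.2 ⟨⟨fun u v => (hr _ u rfl).trans (hr _ v rfl).symm⟩, ?_⟩
  rw [Nat.card_eq_fintype_card, ← edgeFinset_card, edgeFinset_parentGraph h,
    Finset.card_image_of_injOn ((parentGraph_injOn h).mono fun _ => Finset.ne_of_mem_erase),
    Finset.card_erase_of_mem (Finset.mem_univ _), Finset.card_univ, Nat.card_eq_fintype_card]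
  have : 0 < Fintype.card V := Fintype.card_pos_iff.2 ⟨root⟩
  omega

open Classical in
theorem azi_parentGraph [Fintype V] (h : ∀ v, v ≠ root → r (f v) < r v) :
    azi (parentGraph f root) = ∑ v ∈ Finset.univ.erase root,
      aziWeight ((parentGraph f root).degree v) ((parentGraph f root).degree (f v)) := by
  rw [azi_eq_sum_edgeWeight, edgeFinset_parentGraph h,
    Finset.sum_image ((parentGraph_injOn h).mono fun _ => Finset.ne_of_mem_erase)]
  rfl

end Parent

/-- The parent function of a tree with two adjacent vertices of degree three from which four legs
start, three of them of length two. -/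
def doubleSpiderParent (k : ℕ) : ℕ :=
  if k = 2 ∨ k = 4 then 0 else if k = 6 ∨ k = 8 then 1 else k - 1

variable {V : Type*} [Fintype V]

-- The centres are 0 and 1; the legs are 2-3 and 4-5 at 0, and 6-7 and 8-9-10-⋯ at 1, which needs 10
-- vertices. The edge 01 exceeds 8, and every other edge has an end of degree 2.
open Classical in
theorem exists_isTree_lt_azi (hn : 10 ≤ Fintype.card V) :
    ∃ T : SimpleGraph V, T.IsTree ∧ (8 * (Fintype.card V - 1) : ℝ) < azi T := by
  obtain ⟨r, g, hrinj, hrlt, hrg⟩ : ∃ (r : V → ℕ) (g : ℕ → V), Function.Injective r ∧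
      (∀ v, r v < Fintype.card V) ∧ ∀ k < Fintype.card V, r (g k) = k := by
    let e := Fintype.equivFin V
    -- The reduction modulo n only makes `g` total; it is used below n.
    refine ⟨fun v => e v, fun k => e.symm ⟨k % Fintype.card V, Nat.mod_lt _ (by omega)⟩,
      fun u v h => e.injective (Fin.ext h), fun v => (e v).2, fun k hk => ?_⟩
    simp [Nat.mod_eq_of_lt hk]
  set n := Fintype.card V with hnV
  let f : V → V := fun v => g (doubleSpiderParent (r v))
  have hple : ∀ k, doubleSpiderParent k ≤ k := by intro k; unfold doubleSpiderParent; grind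
  have hplt : ∀ k, k ≠ 0 → doubleSpiderParent k < k := by
    intro k hk; unfold doubleSpiderParent; grind
  have hrf : ∀ v, r (f v) = doubleSpiderParent (r v) := fun v =>
    hrg _ ((hple _).trans_lt (hrlt v))
  have hroot : ∀ v, v ≠ g 0 ↔ r v ≠ 0 := fun v => by
    rw [ne_eq, ne_eq, ← hrinj.eq_iff, hrg 0 (by omega)]
  have h : ∀ v, v ≠ g 0 → r (f v) < r v := fun v hv => by
    rw [hrf]; exact hplt _ ((hroot v).1 hv)
  have hadj : ∀ u v, (parentGraph f (g 0)).Adj u v ↔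
      r u ≠ 0 ∧ doubleSpiderParent (r u) = r v ∨ r v ≠ 0 ∧ doubleSpiderParent (r v) = r u := by
    intro u v
    rw [parentGraph_adj h, hroot, hroot, ← hrinj.eq_iff, ← hrinj.eq_iff, hrf, hrf]
  have hgadj : ∀ i j, i < n → j < n → doubleSpiderParent i = j → i ≠ 0 →
      (parentGraph f (g 0)).Adj (g i) (g j) := by
    intro i j hi hj hij hi0
    rw [hadj, hrg i hi, hrg j hj]
    exact Or.inl ⟨hi0, hij⟩
  have hgne : ∀ i j, i < n → j < n → i ≠ j → g i ≠ g j := by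
    intro i j hi hj hij h
    rw [← hrg i hi, ← hrg j hj, h] at hij
    exact hij rfl
  have hdeg3 : ∀ i a b c, i < n → a < n → b < n → c < n → a ≠ b → a ≠ c → b ≠ c →
      (parentGraph f (g 0)).Adj (g i) (g a) → (parentGraph f (g 0)).Adj (g i) (g b) →
      (parentGraph f (g 0)).Adj (g i) (g c) → 3 ≤ (parentGraph f (g 0)).degree (g i) := by
    intro i a b c hi ha hb hc hab hac hbc h1 h2 h3
    rw [← card_neighborFinset_eq_degree, ← Finset.card_eq_three.2 ⟨g a, g b, g c,
      hgne a b ha hb hab, hgne a c ha hc hac, hgne b c hb hc hbc, rfl⟩]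
    refine Finset.card_le_card fun v => ?_
    simp only [Finset.mem_insert, Finset.mem_singleton, mem_neighborFinset]
    rintro (rfl | rfl | rfl) <;> assumption
  have hd0 : 3 ≤ (parentGraph f (g 0)).degree (g 0) := by
    refine hdeg3 0 1 2 4 (by omega) (by omega) (by omega) (by omega) (by omega) (by omega)
      (by omega) (hgadj _ _ ?_ ?_ ?_ ?_).symm (hgadj _ _ ?_ ?_ ?_ ?_).symm
      (hgadj _ _ ?_ ?_ ?_ ?_).symm
    all_goals first | omega | rfl
  have hd1 : 3 ≤ (parentGraph f (g 0)).degree (g 1) := by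
    refine hdeg3 1 0 6 8 (by omega) (by omega) (by omega) (by omega) (by omega) (by omega)
      (by omega) (hgadj _ _ ?_ ?_ ?_ ?_) (hgadj _ _ ?_ ?_ ?_ ?_).symm
      (hgadj _ _ ?_ ?_ ?_ ?_).symm
    all_goals first | omega | rfl
  have hdeg2 : ∀ v, r v + 1 < n → (r v = 2 ∨ r v = 4 ∨ r v = 6 ∨ r v = 8 ∨ 9 ≤ r v) →
      (parentGraph f (g 0)).degree v = 2 := by
    intro v hv hv'
    have : (parentGraph f (g 0)).neighborFinset v = {f v, g (r v + 1)} := by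
      ext q
      rw [mem_neighborFinset, hadj, Finset.mem_insert, Finset.mem_singleton, ← hrinj.eq_iff,
        ← hrinj.eq_iff, hrf, hrg _ hv]
      unfold doubleSpiderParent
      grind
    rw [← card_neighborFinset_eq_degree, this, Finset.card_pair]
    intro h'
    rw [← hrinj.eq_iff, hrf, hrg _ hv] at h'
    have := hple (r v)
    omega
  refine ⟨parentGraph f (g 0), isTree_parentGraph h, ?_⟩
  rw [azi_parentGraph h]
  have hcard : (8 * (n - 1) : ℝ) = ∑ v ∈ Finset.univ.erase (g 0), (8 : ℝ) := by
    rw [Finset.sum_const, Finset.card_erase_of_mem (Finset.mem_univ _), Finset.card_univ, ← hnV,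
      nsmul_eq_mul, Nat.cast_sub (by omega)]
    push_cast
    ring
  rw [hcard]
  have hw1 : 8 < aziWeight ((parentGraph f (g 0)).degree (g 1))
      ((parentGraph f (g 0)).degree (f (g 1))) := by
    refine eight_lt_aziWeight hd1 ?_
    have : f (g 1) = g 0 := by
      rw [← hrinj.eq_iff, hrf, hrg 0 (by omega), hrg 1 (by omega)]
      rfl
    rwa [this]
  refine Finset.sum_lt_sum (fun v hv => ?_) ⟨g 1, ?_, hw1⟩
  · have hv0 := (hroot v).1 (Finset.ne_of_mem_erase hv)
    by_cases hv1 : r v = 1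
    · have : v = g 1 := by rw [← hrinj.eq_iff, hrg 1 (by omega), hv1]
      rw [this]
      exact hw1.le
    · have ha : (parentGraph f (g 0)).Adj v (f v) := by
        rw [hadj, hrf]
        exact Or.inl ⟨hv0, rfl⟩
      have h1 := (degree_pos_iff_exists_adj _ _).2 ⟨_, ha⟩
      have h2 := (degree_pos_iff_exists_adj _ _).2 ⟨_, ha.symm⟩
      have := hrlt v
      -- Otherwise v is the end of a leg, and its parent has degree 2.
      by_cases hv2 : r v + 1 < n ∧ (r v = 2 ∨ r v = 4 ∨ r v = 6 ∨ r v = 8 ∨ 9 ≤ r v)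
      · rw [hdeg2 v hv2.1 hv2.2, aziWeight_two_left h2]
      · rw [hdeg2 (f v), aziWeight_two_right h1]
        all_goals
          rw [hrf]
          unfold doubleSpiderParent
          grind
  · rw [Finset.mem_erase, hroot, hrg 1 (by omega)]
    exact ⟨one_ne_zero, Finset.mem_univ _⟩

open Classical in
theorem IsMaxAziTree.exists_adj_of_ten_le_card {T : SimpleGraph V} (hT : T.IsMaxAziTree)
    (hn : 10 ≤ Fintype.card V) :
    ∃ x y, T.Adj x y ∧ 3 ≤ T.degree x ∧ 3 ≤ T.degree y := by
  by_contra! hno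
  obtain ⟨T', hT', hlt⟩ := exists_isTree_lt_azi hn
  refine (hlt.trans_le (hT.2 T' hT')).not_ge ?_
  have hcard := hT.1.card_edgeFinset
  have : (Fintype.card V - 1 : ℝ) = (T.edgeFinset.card : ℝ) := by
    rw [← hcard]; push_cast; ring
  rw [this, mul_comm, ← nsmul_eq_mul, azi_eq_sum_edgeWeight]
  refine Finset.sum_le_card_nsmul _ _ _ fun e he => ?_
  induction e with
  | h p q =>
    rw [mem_edgeFinset, mem_edgeSet] at he
    rw [edgeWeight_mk]
    have h1 := (degree_pos_iff_exists_adj _ _).2 ⟨_, he⟩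
    have h2 := (degree_pos_iff_exists_adj _ _).2 ⟨_, he.symm⟩
    rcases (by omega : T.degree p = 1 ∨ T.degree p = 2 ∨ 3 ≤ T.degree p) with h | h | h
    · rw [h]; exact aziWeight_one_left_le _
    · rw [h, aziWeight_two_left h2]
    · rcases (by have := hno p q he h; omega : T.degree q = 1 ∨ T.degree q = 2) with h' | h'
      · rw [h', aziWeight_comm]; exact aziWeight_one_left_le _
      · rw [h', aziWeight_two_right h1]

end SimpleGraph

/-! ### Internal paths -/

namespace SimpleGraph

variable {V : Type*} [Fintype V] {T : SimpleGraph V}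

open Classical in
/-- Suppress a vertex `v` of degree two and hang it at a leaf instead. -/
theorem IsTree.exists_suppress (hT : T.IsTree) {u v x : V} (huv : T.Adj u v) (hvx : T.Adj v x)
    (hux : u ≠ x) (hu : 3 ≤ T.degree u) (hv : T.degree v = 2) (hx : 2 ≤ T.degree x) :
    ∃ T' : SimpleGraph V, T'.IsTree ∧ T'.Adj u x ∧
      (∀ p q, T.Adj p q → p ≠ v → q ≠ v → T'.Adj p q) ∧
      (∀ p, T.degree p ≠ 1 → p ≠ v → T'.degree p = T.degree p) ∧
      azi T + aziWeight (T.degree u) (T.degree x) ≤ azi T' + 8 := by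
  have : Nontrivial V := ⟨u, v, huv.ne⟩
  obtain ⟨z, hz⟩ := hT.exists_vert_degree_one_of_nontrivial
  have hzu : z ≠ u := by rintro rfl; omega
  have hzv : z ≠ v := by rintro rfl; omega
  have hzx : z ≠ x := by rintro rfl; omega
  have hr : (T.deleteEdges {s(u, v)}).Reachable v x := by
    refine Adj.reachable ?_
    rw [deleteEdges_adj]
    refine ⟨hvx, ?_⟩
    rw [Set.mem_singleton_iff, Sym2.eq_iff]
    rintro (h | h)
    · exact huv.ne' h.1
    · exact hux h.2.symm
  have hnux : ¬ T.Adj u x := fun h => by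
    refine hT.not_adj_of_reachable_deleteEdges huv hr (Adj.reachable ?_)
    rw [deleteEdges_adj]
    refine ⟨h, ?_⟩
    rw [Set.mem_singleton_iff, Sym2.eq_iff]
    rintro (h | h)
    · exact hvx.ne' h.2
    · exact huv.ne h.1
  have hnbr : ∀ q, T.Adj v q → q = u ∨ q = x := fun q =>
    eq_or_eq_of_degree_eq_two hv huv.symm hvx hux
  have hT₁ := hT.slide huv hr
  have hd₁ := degree_slide huv hnux hux
  have hvx₁ : (T.slide u v x).Adj v x := by
    rw [slide_adj]
    refine Or.inl ⟨hvx, ?_⟩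
    rintro (h | h)
    · exact huv.ne' h.1
    · exact hux h.2.symm
  have hdv₁ : (T.slide u v x).degree v = 1 := by rw [hd₁, if_pos rfl, hv]
  have hnvz : ¬ (T.slide u v x).Adj v z := fun h => hzx (eq_of_degree_eq_one hdv₁ hvx₁ h)
  have hT₂ := hT₁.slide hvx₁ (hT₁.reachable_of_leaf hdv₁ hvx₁ hzv)
  have hd₂ := degree_slide hvx₁ hnvz hzv.symm
  simp only [hd₁] at hd₂
  -- The first slide shortcuts v and leaves it as a leaf at x; the second moves that leaf to z.
  set T' := (T.slide u v x).slide v x z with hT'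
  have hadj : ∀ p q, T'.Adj p q ↔ T.Adj p q ∧ p ≠ v ∧ q ≠ v ∨
      (p = u ∧ q = x ∨ p = x ∧ q = u ∨ p = v ∧ q = z ∨ p = z ∧ q = v) := by
    intro p q
    have h1 := huv.ne
    have h2 := hvx.ne
    have h3 : T.Adj p q → p = v → q = u ∨ q = x := by rintro h rfl; exact hnbr _ h
    have h4 : T.Adj p q → q = v → p = u ∨ p = x := by rintro h rfl; exact hnbr _ h.symm
    rw [hT', slide_adj, slide_adj]
    grind
  have hdz : T'.degree z = 2 := by
    rw [hd₂, if_neg hzx, if_pos rfl, if_neg hzv, if_neg hzx, hz]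
  have hdv : T'.degree v = 1 := by
    rw [hd₂, if_neg hvx.ne, if_neg hzv.symm, if_pos rfl, hv]
  have hd : ∀ p, p ≠ z → p ≠ v → T'.degree p = T.degree p := by
    intro p hpz hpv
    rw [hd₂, if_neg hpz, if_neg hpv]
    split_ifs <;> omega
  refine ⟨T', hT₂, (hadj _ _).2 (by tauto), fun p q h hp hq => (hadj _ _).2 (by tauto),
    fun p hp hpv => hd p (by rintro rfl; exact hp hz) hpv, ?_⟩
  have hE : T'.edgeFinset =
      (T.edgeFinset \ {s(u, v), s(v, x)}) ∪ {s(u, x), s(v, z)} := by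
    ext e
    induction e with
    | h p q =>
      have h3 : T.Adj p q → p = v → q = u ∨ q = x := by rintro h rfl; exact hnbr _ h
      have h4 : T.Adj p q → q = v → p = u ∨ p = x := by rintro h rfl; exact hnbr _ h.symm
      simp only [mem_edgeFinset, mem_edgeSet, hadj, Finset.mem_union, Finset.mem_sdiff,
        Finset.mem_singleton, Finset.mem_insert, Sym2.eq_iff]
      grind
  have hnvz' : ¬ T.Adj v z := fun h => (hnbr z h).elim hzu hzx
  have key := azi_add_sum_le (G := T) (G' := T') (A := {s(u, v), s(v, x)})
    (B := {s(u, x), s(v, z)}) (by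
      rw [Finset.insert_subset_iff, Finset.singleton_subset_iff, mem_edgeFinset, mem_edgeFinset]
      exact ⟨huv, hvx⟩) (by
      rw [Finset.disjoint_right]
      intro e he
      rw [Finset.mem_insert, Finset.mem_singleton] at he
      rw [Finset.mem_sdiff, not_and_or, mem_edgeFinset]
      rcases he with rfl | rfl
      · exact Or.inl hnux
      · exact Or.inl hnvz') hE (by
      -- The old edge at z, now of degree 2, weighs 8 and weighed at most 8 before.
      have half : ∀ p q, T.Adj p q → p ≠ v → q ≠ v → p = z →
          aziWeight (T.degree p) (T.degree q) ≤ aziWeight (T'.degree p) (T'.degree q) := by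
        rintro p q hpq - hqv rfl
        have := (degree_pos_iff_exists_adj _ _).2 ⟨_, hpq.symm⟩
        rw [hdz, hz, hd q hpq.ne' hqv, aziWeight_two_left this]
        exact aziWeight_one_left_le _
      intro p q hpq hA
      simp only [Finset.mem_singleton, Finset.mem_insert, Sym2.eq_iff] at hA
      have hpv : p ≠ v := by rintro rfl; have := hnbr q hpq; tauto
      have hqv : q ≠ v := by rintro rfl; have := hnbr p hpq.symm; tauto
      by_cases hp : p = z
      · exact half p q hpq hpv hqv hp
      by_cases hq : q = z
      · rw [aziWeight_comm, aziWeight_comm (T'.degree p : ℝ)]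
        exact half q p hpq.symm hqv hpv hq
      · rw [hd p hp hpv, hd q hq hqv])
  have hne1 : s(u, v) ≠ s(v, x) := by
    rw [ne_eq, Sym2.eq_iff]; have := huv.ne; tauto
  have hne2 : s(u, x) ≠ s(v, z) := by
    rw [ne_eq, Sym2.eq_iff]; have := huv.ne; tauto
  rw [Finset.sum_pair hne1, Finset.sum_pair hne2] at key
  simp only [edgeWeight_mk] at key
  rw [hd u hzu.symm huv.ne, hd x hzx.symm hvx.ne', hdz, hdv, hv,
    aziWeight_two_left (by omega : 1 ≤ T.degree x), aziWeight_two_right (by omega : 1 ≤ T.degree u),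
    aziWeight_two_right le_rfl] at key
  linarith

theorem Walk.getVert_transfer {V : Type*} {G H : SimpleGraph V} {u v : V} (p : G.Walk u v)
    (h : ∀ e ∈ p.edges, e ∈ H.edgeSet) (i : ℕ) : (p.transfer H h).getVert i = p.getVert i := by
  induction p generalizing i with
  | nil => rfl
  | cons _ p ih =>
    cases i with
    | zero => rfl
    | succ i => exact ih _ i

open Classical in
theorem IsMaxAziTree.not_isInternalPath {n : ℕ} : ∀ {T : SimpleGraph V}, T.IsMaxAziTree →
    ∀ {u w : V} (p : T.Walk u w), IsInternalPath p → p.length ≠ n + 2 := by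
  induction n with
  | zero =>
    rintro T hT u w (_ | ⟨huv, _ | ⟨hvx, _ | ⟨h, q⟩⟩⟩) ⟨hp, hu, hw, hi⟩ hl
    · simp at hl
    · simp at hl
    · have hux : u ≠ w := by
        rintro rfl
        simp at hp
      obtain ⟨T', hT', -, -, -, hle⟩ := hT.1.exists_suppress huv hvx hux hu
        (hi 1 (by simp) (by simp)) hw.le
      have := hT.2 T' hT'
      have := eight_lt_aziWeight hu hw
      linarith
    · simp at hl
  | succ n ih =>
    rintro T hT u w (_ | @⟨_, v, _, huv, _ | @⟨_, x, _, hvx, q⟩⟩) ⟨hp, hu, hw, hi⟩ hl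
    · simp at hl
    · simp at hl
    · simp only [Walk.length_cons] at hl hi
      rw [Walk.cons_isPath_iff, Walk.cons_isPath_iff] at hp
      have hus : u ∉ q.support := fun h => hp.2 (by simp [h])
      have hux : u ≠ x := by
        rintro rfl
        exact hus q.start_mem_support
      have hv : T.degree v = 2 := hi 1 (by omega) (by omega)
      have hx : T.degree x = 2 := by
        rw [← q.getVert_zero]
        exact hi 2 (by omega) (by omega)
      obtain ⟨T', hT', hux', hadj, hdeg, hle⟩ := hT.1.exists_suppress huv hvx hux hu hv hx.ge
      rw [hx, aziWeight_two_right (by omega)] at hle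
      -- Since x has degree 2, the edge ux weighs 8 and suppression costs nothing.
      have hmax : T'.IsMaxAziTree := ⟨hT', fun S hS => (hT.2 S hS).trans (by linarith)⟩
      have hne : ∀ a ∈ q.support, a ≠ v := by
        rintro a ha rfl
        exact hp.1.2 ha
      have hedge : ∀ e ∈ q.edges, e ∈ T'.edgeSet := by
        intro e he
        induction e with
        | h a b =>
          exact hadj a b (q.adj_of_mem_edges he) (hne _ (q.fst_mem_support_of_mem_edges he))
            (hne _ (q.snd_mem_support_of_mem_edges he))
      refine ih hmax (Walk.cons hux' (q.transfer T' hedge)) ⟨?_, ?_, ?_, ?_⟩ ?_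
      · rw [Walk.cons_isPath_iff, Walk.support_transfer]
        exact ⟨hp.1.1.transfer _, hus⟩
      · rwa [hdeg u (by omega) huv.ne]
      · rwa [hdeg w (by omega) (hne _ q.end_mem_support)]
      · rintro (_ | i) h0 hlt
        · omega
        · rw [Walk.length_cons, Walk.length_transfer] at hlt
          have h2 : T.degree (q.getVert i) = 2 := hi (i + 2) (by omega) (by omega)
          rw [Walk.getVert_cons_succ, Walk.getVert_transfer,
            hdeg _ (by omega) (hne _ (q.getVert_mem_support i)), h2]
      · rw [Walk.length_cons, Walk.length_transfer]
        omega

/-! ### Pendent paths -/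

theorem IsPendentPath.reverse {u v : V} {p : T.Walk u v} (hp : IsPendentPath p) :
    IsPendentPath p.reverse := by
  refine ⟨hp.1.reverse, hp.2.1.symm.imp And.symm And.symm, fun i h0 hi => ?_⟩
  rw [Walk.length_reverse] at hi
  rw [Walk.getVert_reverse]
  exact hp.2.2 _ (by omega) (by omega)

open Classical in
theorem IsMaxAziTree.length_lt_four_of_isPendentPath (hT : T.IsMaxAziTree)
    (hn : 10 ≤ Fintype.card V) {u v : V} (p : T.Walk u v) (hp : IsPendentPath p) :
    p.length < 4 := by
  wlog hu : T.degree u = 1 generalizing u v p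
  · rw [← Walk.length_reverse]
    exact this p.reverse hp.reverse ((hp.2.1.resolve_left fun h => hu h.1).2)
  by_contra! hl
  obtain ⟨x, y, hxy, hx, hy⟩ := hT.exists_adj_of_ten_le_card hn
  refine hT.not_chain_of_adj hxy hx hy (p.adj_getVert_succ (i := 0) (by omega))
    (p.adj_getVert_succ (by omega)) (p.adj_getVert_succ (by omega)) ?_ (by rwa [p.getVert_zero])
    (hp.2.2 1 (by omega) (by omega)) (hp.2.2 2 (by omega) (by omega))
    (hp.2.2 3 (by omega) (by omega))
  intro h
  have := hp.1.getVert_injOn (by simp; omega) (by simp; omega) h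
  omega

open Classical in
theorem IsMaxAziTree.toSubgraph_eq_of_isPendentPath (hT : T.IsMaxAziTree)
    (hn : 10 ≤ Fintype.card V) {u v u' v' : V} (p : T.Walk u v) (q : T.Walk u' v')
    (hp : IsPendentPath p) (hpl : p.length = 3) (hq : IsPendentPath q) (hql : q.length = 3) :
    p.toSubgraph = q.toSubgraph := by
  wlog hu : T.degree u = 1 generalizing u v p
  · rw [← p.toSubgraph_reverse]
    exact this p.reverse hp.reverse (by simpa using hpl)
      ((hp.2.1.resolve_left fun h => hu h.1).2)
  wlog hu' : T.degree u' = 1 generalizing u' v' q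
  · rw [← q.toSubgraph_reverse]
    exact this q.reverse hq.reverse (by simpa using hql)
      ((hq.2.1.resolve_left fun h => hu' h.1).2)
  obtain ⟨hpp, hpe, hpi⟩ := hp
  obtain ⟨hqp, hqe, hqi⟩ := hq
  have hv : 2 < T.degree v := by omega
  have hv' : 2 < T.degree v' := by omega
  rw [hpl] at hpi
  rw [hql] at hqi
  have hb := hpi 1 (by omega) (by omega)
  have hc := hpi 2 (by omega) (by omega)
  have hb' := hqi 1 (by omega) (by omega)
  have hc' := hqi 2 (by omega) (by omega)
  clear hpi hqi hpe hqe
  obtain _ | @⟨_, b, _, hab, _ | @⟨_, c, _, hbc, _ | @⟨_, d, _, hcd, _ | ⟨_, _⟩⟩⟩⟩ := p <;>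
    simp only [Walk.length_nil, Walk.length_cons] at hpl <;> try omega
  obtain _ | @⟨_, b', _, hab', _ | @⟨_, c', _, hbc', _ | @⟨_, d', _, hcd', _ | ⟨_, _⟩⟩⟩⟩ := q <;>
    simp only [Walk.length_nil, Walk.length_cons] at hql <;> try omega
  replace hb : T.degree b = 2 := hb
  replace hc : T.degree c = 2 := hc
  replace hb' : T.degree b' = 2 := hb'
  replace hc' : T.degree c' = 2 := hc'
  -- From a common leaf the degree-2 vertices leave no choice, so the paths coincide.
  by_cases huu : u = u'
  · subst huu
    obtain rfl := eq_of_degree_eq_one hu hab hab'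
    obtain rfl : c' = c := (eq_or_eq_of_degree_eq_two hb hab.symm hbc
      (by rintro rfl; omega) hbc').resolve_left (by rintro rfl; omega)
    obtain rfl : v' = v := (eq_or_eq_of_degree_eq_two hc hbc.symm hcd
      (by rintro rfl; omega) hcd').resolve_left (by rintro rfl; omega)
    rfl
  exfalso
  have hbb : b' ≠ b := by
    rintro rfl
    rcases eq_or_eq_of_degree_eq_two hb hab.symm hbc (by rintro rfl; omega) hab'.symm
      with rfl | rfl
    · exact huu rfl
    · omega
  have hcb : c' ≠ b := by
    rintro rfl
    rcases eq_or_eq_of_degree_eq_two hb hbc'.symm hcd' (by rintro rfl; omega) hab.symm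
      with rfl | rfl <;> omega
  have hub : u' ≠ b := by rintro rfl; omega
  have huc : u' ≠ c' := by rintro rfl; omega
  have hub' : u ≠ b' := by rintro rfl; omega
  have huc' : u ≠ c' := by rintro rfl; omega
  -- Hanging u at u' gives the chain u, u', b', c' with degrees 1, 2, 2, 2 in a tree that is still
  -- maximum.
  have hmax := hT.slide_leaf hab hbc hu hb hc hab' hu' huu hbb
  obtain ⟨x, y, hxy, hx, hy⟩ := hmax.exists_adj_of_ten_le_card hn
  have hd := degree_slide hab (fun h => hub (eq_of_degree_eq_one hu hab h)) huu
  refine hmax.not_chain_of_adj hxy hx hy (a := u) (b := u') (c := b') (d := c') ?_ ?_ ?_ huc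
    ?_ ?_ ?_ ?_
  · exact slide_adj.2 (Or.inr ⟨Or.inl ⟨rfl, rfl⟩, huu⟩)
  · exact slide_adj.2 (Or.inl ⟨hab', by tauto⟩)
  · exact slide_adj.2 (Or.inl ⟨hbc', by tauto⟩)
  · rw [hd, if_neg hab.ne, if_neg huu, hu]
  · rw [hd, if_neg hub, if_pos rfl, hu']
  · rw [hd, if_neg hbb, if_neg hab'.ne', hb']
  · rw [hd, if_neg hcb, if_neg huc.symm, hc']

end SimpleGraph

theorem theorem2 {V : Type*} [Fintype V] (hn : 10 ≤ Fintype.card V)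
    (T : SimpleGraph V) (hT : T.IsMaxAziTree) :
    (∀ (u v : V) (p : T.Walk u v), SimpleGraph.IsInternalPath p → ¬ 2 ≤ p.length) ∧
    (∀ (u v : V) (p : T.Walk u v), SimpleGraph.IsPendentPath p → ¬ 4 ≤ p.length) ∧
    (∀ (u v u' v' : V) (p : T.Walk u v) (q : T.Walk u' v'),
      SimpleGraph.IsPendentPath p → p.length = 3 →
      SimpleGraph.IsPendentPath q → q.length = 3 →
      p.toSubgraph = q.toSubgraph) := by
  refine ⟨fun u v p hp hl => ?_, fun u v p hp =>
    (hT.length_lt_four_of_isPendentPath hn p hp).not_ge,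
    fun u v u' v' p q hp hpl hq hql => hT.toSubgraph_eq_of_isPendentPath hn p q hp hpl hq hql⟩
  exact hT.not_isInternalPath (n := p.length - 2) p hp (by omega)
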